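/- For a finite simple graph $G$ and an integer $s\ge 1$, the hat guessing number $\mathrm{HG}_s(G)$ is the maximum integer $k$ for which the players win the following game: a player sits at each vertex of $G$, an adversary gives each player a hat with a color from $\{1,\dots,k\}$, each player sees exactly the hats of the players at neighboring vertices and makes $s$ guesses of his own hat color, without hearing the guesses of the others and according to a deterministic strategy fixed in advance, and the players win if their strategy guarantees that, for every (not necessarily proper) assignment of hats, at least one player names his own color among his guesses. For $U\subseteq V(G)$ let $N(U)$ be the set of vertices with at least one neighbor in $U$. For a partition $V_1,\dots,V_t$ of $V(G)$ into nonempty sets, the quotient graph $G/(V_1,\dots,V_t)$ has the vertices $1,\dots,t$, and distinct $i,j$ are adjacent when some edge of $G$ joins $V_i$ and $V_j$. **Theorem.** Let $r,s\ge 1$ be integers and let $\ell$ be an integer. Let $G$ be a finite graph, and let $V_1,\dots,V_t$ be a partition of $V(G)$ such that the quotient graph $G/(V_1,\dots,V_t)$ is a tree. Suppose that $|N(V_i)\cap V_j|\le r$ for all $i\ne j$. If $\mathrm{HG}_s(G[V_i])<\ell$ for all $1\le i\le t$, then $$\mathrm{HG}_s(G)\le (3\ell)^{r\ell^{r-1}}\quad\text{when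 } r\ge 2,\qquad \mathrm{HG}_s(G)\le \ell(\ell-1)\quad\text{when } r=1.$$ -/

import Mathlib

namespace HatGuessing

/-- A deterministic guessing strategy on `G` with color set `{0, …, k-1}` and at most `s` guesses
per player: the player at `v` sees exactly the hats on the neighbors of `v` and names a set of at
most `s` colors. -/
structure Strategy {V : Type*} (G : SimpleGraph V) (s k : ℕ) where
  /-- the set of colors guessed at `v`, as a function of the coloring of the neighborhood of `v` -/
  guess : ∀ v : V, (G.neighborSet v → Fin k) → Finset (Fin k)
  card_guess_le : ∀ v c, (guess v c).card ≤ s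

/-- A strategy is winning if for every (not necessarily proper) coloring `φ` of the vertices at
least one vertex has its own color among its guesses. -/
def Strategy.IsWinning {V : Type*} {G : SimpleGraph V} {s k : ℕ} (Γ : Strategy G s k) : Prop :=
  ∀ φ : V → Fin k, ∃ v : V, φ v ∈ Γ.guess v (fun u => φ u)

/-- The players win the game on `G` with `k` hat colors and `s` guesses per player. -/
def PlayersWin {V : Type*} (G : SimpleGraph V) (s k : ℕ) : Prop :=
  ∃ Γ : Strategy G s k, Γ.IsWinning

/-- The hat guessing number `HG_s(G)`: the maximum number `k` of colors for which the players win.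
For a finite graph with at least one vertex the maximum exists, see `isGreatest_HG`; for the
graph without vertices the value is `0`. -/
noncomputable def HG {V : Type*} (G : SimpleGraph V) (s : ℕ) : ℕ :=
  sSup {k : ℕ | PlayersWin G s k}

theorem PlayersWin.le {V : Type*} [Fintype V] {G : SimpleGraph V} {s k : ℕ}
    (h : PlayersWin G s k) : k ≤ Fintype.card V * s := by
  classical
  obtain ⟨Γ, hΓ⟩ := h
  rcases Nat.eq_zero_or_pos k with rfl | hk
  · exact Nat.zero_le _
  have hcover : (Finset.univ : Finset (V → Fin k)) ⊆ Finset.univ.biUnion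
      (fun v : V => Finset.univ.filter (fun φ : V → Fin k => φ v ∈ Γ.guess v (fun u => φ u))) := by
    intro φ _
    simpa using hΓ φ
  have hone : ∀ v : V, (Finset.univ.filter
      (fun φ : V → Fin k => φ v ∈ Γ.guess v (fun u => φ u))).card
        ≤ s * k ^ (Fintype.card V - 1) := by
    intro v
    let f : (V → Fin k) → ({u : V // u ≠ v} → Fin k) := fun φ u => φ u
    refine (Finset.card_le_mul_card_image (f := f) _ s ?_).trans
      (Nat.mul_le_mul_left s ((Finset.card_le_univ _).trans (le_of_eq ?_)))
    · intro a ha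
      obtain ⟨ψ, -, rfl⟩ := Finset.mem_image.1 ha
      refine (Finset.card_le_card_of_injOn (fun φ => φ v) ?_ ?_).trans
        (Γ.card_guess_le v (fun u => ψ u))
      · intro φ hφ
        simp only [Finset.coe_filter, Finset.mem_filter, Finset.mem_univ, true_and,
          Set.mem_ofPred_eq] at hφ
        have e : (fun u : G.neighborSet v => φ u) = fun u : G.neighborSet v => ψ u := by
          funext u
          exact congrFun hφ.2 ⟨u, (G.ne_of_adj u.2).symm⟩
        rw [e] at hφ
        exact hφ.1
      · intro φ hφ φ' hφ' hv
        simp only [Finset.coe_filter, Finset.mem_filter, Finset.mem_univ, true_and,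
          Set.mem_ofPred_eq] at hφ hφ'
        funext u
        by_cases hu : u = v
        · subst hu
          exact hv
        · exact congrFun (hφ.2.trans hφ'.2.symm) ⟨u, hu⟩
    · simp [Fintype.card_subtype_compl]
  have htot := (Finset.card_le_card hcover).trans
    (Finset.card_biUnion_le_card_mul _ _ _ (fun v _ => hone v))
  simp only [Finset.card_univ, Fintype.card_fun, Fintype.card_fin] at htot
  rcases isEmpty_or_nonempty V with hV | hV
  · simp at htot
  obtain ⟨m, hm⟩ : ∃ m, Fintype.card V = m + 1 :=
    Nat.exists_eq_succ_of_ne_zero Fintype.card_ne_zero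
  rw [hm] at htot ⊢
  rw [Nat.add_sub_cancel, pow_succ, ← mul_assoc, mul_comm (k ^ m)] at htot
  exact Nat.le_of_mul_le_mul_right htot (pow_pos hk m)

/-- On a finite graph with at least one vertex, `HG G s` is a genuine maximum. -/
theorem isGreatest_HG {V : Type*} [Finite V] [Nonempty V] (G : SimpleGraph V) (s : ℕ) :
    IsGreatest {k : ℕ | PlayersWin G s k} (HG G s) := by
  cases nonempty_fintype V
  have hb : BddAbove {k : ℕ | PlayersWin G s k} :=
    ⟨Fintype.card V * s, fun k hk => PlayersWin.le hk⟩
  refine ⟨Nat.sSup_mem ⟨0, ⟨⟨fun _ _ => ∅, by simp⟩, fun φ => ?_⟩⟩ hb, fun k hk => le_csSup hb hk⟩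
  exact (φ (Classical.arbitrary V)).elim0

/-- `N(U)`: the set of vertices with at least one neighbor in `U`. -/
def nbhd {V : Type*} (G : SimpleGraph V) (U : Set V) : Set V :=
  {w | ∃ u ∈ U, G.Adj w u}

/-- `P` is an indexed partition of the type `V`: its members are nonempty, pairwise disjoint, and
cover `V`. -/
structure IsVertexPartition {V ι : Type*} (P : ι → Set V) : Prop where
  nonempty : ∀ i, (P i).Nonempty
  disjoint : ∀ i j, i ≠ j → Disjoint (P i) (P j)
  cover : ∀ v, ∃ i, v ∈ P i

/-- The quotient graph of `G` by the sets `P i`: one vertex for every index, two distinct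
indices being adjacent if some edge of `G` joins the corresponding sets. -/
def quotientGraph {V ι : Type*} (G : SimpleGraph V) (P : ι → Set V) : SimpleGraph ι where
  Adj i j := i ≠ j ∧ ∃ u ∈ P i, ∃ v ∈ P j, G.Adj u v
  symm := ⟨fun _ _ ⟨hne, u, hu, v, hv, h⟩ => ⟨hne.symm, v, hv, u, hu, h.symm⟩⟩
  loopless := ⟨fun _ h => h.1 rfl⟩

end HatGuessing

/-! Root the quotient tree and build a losing coloring from the leaves up. The invariant for the
branch at a part: whatever the coloring outside and whatever lists of `ℓ` colors are put on that
part, some losing coloring of the branch uses the lists there.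

A parent and a child part meet in at most `r` vertices on each side. Fix the parent's side; the
patterns on the child's side that do not extend to a losing coloring contain no box of side `ℓ`,
since the sides of such a box could serve as lists. The parent's side has at most `ℓ ^ r` list
colorings, hence there are at most that many bad sets. For large `k` they miss some pattern, which
works for every list coloring of the parent (`exists_interface`). Fix these patterns for all
children, color the parent from its lists in that frozen environment, then fill in the branches.

That box-free sets cannot cover is Erdős's box theorem, the multipartite Kővári–Sós–Turán bound
(`exists_piFinset_subset_of_card`); for `r = 1` plain counting suffices. -/

namespace HatGuessing

/-! ### Rooting the tree; playing with lists -/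

/-- A tree can be rooted: it has a root, a parent map and a depth function such that every edge
joins a vertex to its parent. -/
theorem exists_parent_of_isTree {ι : Type*} {T : SimpleGraph ι} (hT : T.IsTree) :
    ∃ (ρ : ι) (par : ι → ι) (dep : ι → ℕ), par ρ = ρ ∧ (∀ a, a ≠ ρ → dep (par a) < dep a) ∧
      ∀ a b, T.Adj a b → b = par a ∨ a = par b := by
  obtain ⟨ρ⟩ := hT.connected.nonempty
  choose f hf using fun a => (hT.connected ρ a).exists_path_of_dist
  refine ⟨ρ, fun a => (f a).penultimate, T.dist ρ, ?_, ?_, ?_⟩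
  · have h := (hf ρ).2
    rw [SimpleGraph.dist_self] at h
    exact (SimpleGraph.Walk.eq_of_length_eq_zero
      (p := (f ρ).dropLast) (by simp [h])).symm
  · intro a ha
    have h1 := SimpleGraph.dist_le (f a).dropLast
    have h2 : 0 < T.dist ρ a := hT.connected.pos_dist_of_ne ha.symm
    have h3 := (hf a).2
    simp only [SimpleGraph.Walk.length_dropLast] at h1 ⊢
    omega
  · intro a b hab
    by_cases hb : b ∈ (f a).support
    · exact Or.inl (hT.isAcyclic.eq_penultimate_of_adj_end (hf a).1 hab hb)
    · refine Or.inr (hT.isAcyclic.eq_penultimate_of_adj_end (hf b).1 hab.symm ?_)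
      by_contra ha
      exact hb (hT.isAcyclic.mem_support_of_ne_mem_support_of_adj_of_isPath (hf a).1 (hf b).1
        hab ha)

/-- If the players lose with `ℓ` colors, they lose with any color set when the adversary is
restricted to lists of `ℓ` colors. -/
theorem exists_coloring_of_lists {V : Type*} {H : SimpleGraph V} {s ℓ : ℕ}
    (hlose : ¬ PlayersWin H s ℓ) {κ : Type*} (g : V → (V → κ) → Finset κ)
    (hcard : ∀ v φ, (g v φ).card ≤ s)
    (hloc : ∀ v φ ψ, (∀ w, H.Adj v w → φ w = ψ w) → g v φ = g v ψ)
    (L : V → Finset κ) (hL : ∀ v, (L v).card = ℓ) :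
    ∃ φ : V → κ, (∀ v, φ v ∈ L v) ∧ ∀ v, φ v ∉ g v φ := by
  classical
  rcases Nat.eq_zero_or_pos ℓ with rfl | hℓ
  · have : IsEmpty V := by
      by_contra h
      rw [not_isEmpty_iff] at h
      exact hlose ⟨⟨fun _ _ => ∅, by simp⟩, fun φ => (φ (Classical.arbitrary V)).elim0⟩
    exact ⟨isEmptyElim, isEmptyElim, isEmptyElim⟩
  let e : ∀ v, Fin ℓ ≃ L v := fun v => ((L v).equivFinOfCardEq (hL v)).symm
  -- Colors of unseen vertices are arbitrary; `hloc` makes them irrelevant.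
  let ext : ∀ v, (H.neighborSet v → Fin ℓ) → V → κ := fun v c w =>
    if h : w ∈ H.neighborSet v then e w (c ⟨w, h⟩) else e w ⟨0, hℓ⟩
  let Γ : Strategy H s ℓ :=
    { guess := fun v c => Finset.univ.filter fun a => (e v a : κ) ∈ g v (ext v c)
      card_guess_le := fun v c => by
        refine (Finset.card_le_card_of_injOn (fun a => (e v a : κ)) ?_ ?_).trans
          (hcard v (ext v c))
        · intro a ha
          simpa using ha
        · intro a _ b _ h
          exact (e v).injective (Subtype.ext h) }
  have hΓ : ¬ Γ.IsWinning := fun h => hlose ⟨Γ, h⟩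
  simp only [Strategy.IsWinning, not_forall, not_exists] at hΓ
  obtain ⟨φ, hφ⟩ := hΓ
  refine ⟨fun v => e v (φ v), fun v => (e v (φ v)).2, fun v hv => hφ v ?_⟩
  simp only [Γ, Finset.mem_filter, Finset.mem_univ, true_and]
  rwa [hloc v _ (fun w => e w (φ w))]
  intro w hw
  simp [ext, hw]

/-! ### Boxes in dense sets -/

/-- A finset of functions with values in a `k`-element set of size at least `k ^ (m + 1) / d`
contains a box with all sides of size `ℓ`, if `k` is large in terms of `d`, `ℓ` and `m`. -/
theorem exists_piFinset_subset_of_card {κ : Type*} [Fintype κ] [DecidableEq κ] {ℓ : ℕ}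
    (hℓ : 2 ≤ ℓ) (m : ℕ) : ∀ (d : ℕ) (B : Finset (Fin (m + 1) → κ)), 1 ≤ d →
      Fintype.card κ ^ (m + 1) ≤ B.card * d → ℓ * (4 * d) ^ ℓ ^ m ≤ Fintype.card κ →
      ∃ S : Fin (m + 1) → Finset κ, (∀ i, (S i).card = ℓ) ∧ Fintype.piFinset S ⊆ B := by
  induction m with
  | zero =>
    intro d B hd hB hk
    have h1 : ℓ ≤ B.card := by
      simp only [zero_add, pow_one, pow_zero] at hB hk
      have : ℓ * d ≤ B.card * d := by nlinarith
      exact Nat.le_of_mul_le_mul_right this hd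
    obtain ⟨B', hB', hc⟩ := Finset.exists_subset_card_eq h1
    refine ⟨fun _ => B'.image fun f => f 0, fun _ => ?_, ?_⟩
    · rw [Finset.card_image_of_injective, hc]
      intro f g h
      funext i
      rw [Fin.fin_one_eq_zero i]
      exact h
    · intro f hf
      rw [Fintype.mem_piFinset] at hf
      obtain ⟨g, hg, hfg⟩ := Finset.mem_image.1 (hf 0)
      have : g = f := by
        funext i
        rw [Fin.fin_one_eq_zero i]
        exact hfg
      exact hB' (this ▸ hg)
  | succ m ih =>
    intro d B hd hB hk
    set k := Fintype.card κ with hkdef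
    set K := k ^ (m + 1) with hK
    let F : (Fin (m + 1) → κ) → Finset κ := fun y => Finset.univ.filter fun a => Fin.cons a y ∈ B
    let C : Finset κ → Finset (Fin (m + 1) → κ) := fun S => Finset.univ.filter fun y => S ⊆ F y
    -- Some `ℓ`-set lies in the fibers over a `1 / (2 * d) ^ ℓ` fraction of the points `y`.
    -- Otherwise, double counting pairs `S ⊆ F y` contradicts convexity.
    obtain ⟨S, hS, hCS⟩ : ∃ S : Finset κ, S.card = ℓ ∧ K ≤ (C S).card * (2 * d) ^ ℓ := by
      by_contra! hcon
      have hkpos : 0 < k := lt_of_lt_of_le (by positivity) hk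
      have hKcard : (Finset.univ : Finset (Fin (m + 1) → κ)).card = K := by
        simp [hK, hkdef]
      have hsumF : ∑ y, (F y).card = B.card := by
        rw [← Finset.card_sigma]
        refine Finset.card_bij (fun p _ => Fin.cons p.2 p.1) ?_ ?_ ?_
        · rintro ⟨y, a⟩ h
          simpa [F] using h
        · rintro ⟨y, a⟩ _ ⟨z, b⟩ _ h
          obtain ⟨rfl, rfl⟩ := Fin.cons_inj.1 h
          rfl
        · intro f hf
          exact ⟨⟨Fin.tail f, f 0⟩, by simpa [F] using hf, by simp⟩
      have hdouble : ∑ y, ((F y).card).choose ℓ =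
          ∑ S ∈ (Finset.univ : Finset κ).powersetCard ℓ, (C S).card := by
        have := Finset.sum_card_bipartiteAbove_eq_sum_card_bipartiteBelow
          (s := (Finset.univ : Finset (Fin (m + 1) → κ)))
          (t := (Finset.univ : Finset κ).powersetCard ℓ) (fun y S => S ⊆ F y)
        simp only [Finset.bipartiteAbove, Finset.bipartiteBelow] at this
        rw [← this]
        refine Finset.sum_congr rfl fun y _ => ?_
        rw [← Finset.card_powersetCard]
        congr 1
        ext S
        simp [Finset.mem_powersetCard, and_comm]
      have hupper : (∑ y, ((F y).card + 1 - ℓ) ^ ℓ) * (2 * d) ^ ℓ < K * k ^ ℓ := by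
        have hne : ((Finset.univ : Finset κ).powersetCard ℓ).Nonempty := by
          refine Finset.powersetCard_nonempty.2 ?_
          rw [Finset.card_univ]
          refine le_trans ?_ hk
          exact Nat.le_mul_of_pos_right _ (by positivity)
        have h1 : (∑ y, ((F y).card).choose ℓ) * (2 * d) ^ ℓ < k.choose ℓ * K := by
          rw [hdouble, Finset.sum_mul]
          refine (Finset.sum_lt_sum_of_nonempty hne fun S hS =>
            hcon S (Finset.mem_powersetCard.1 hS).2).trans_eq ?_
          simp [hkdef]
        calc (∑ y, ((F y).card + 1 - ℓ) ^ ℓ) * (2 * d) ^ ℓ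
            ≤ (∑ y, ((F y).card).descFactorial ℓ) * (2 * d) ^ ℓ :=
              Nat.mul_le_mul_right _ (Finset.sum_le_sum fun y _ =>
                Nat.pow_sub_le_descFactorial _ _)
          _ = ℓ.factorial * ((∑ y, ((F y).card).choose ℓ) * (2 * d) ^ ℓ) := by
              simp only [Nat.descFactorial_eq_factorial_mul_choose, ← Finset.mul_sum]
              ring
          _ < ℓ.factorial * (k.choose ℓ * K) := Nat.mul_lt_mul_of_pos_left h1 (Nat.factorial_pos _)
          _ = k.descFactorial ℓ * K := by rw [Nat.descFactorial_eq_factorial_mul_choose]; ring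
          _ ≤ k ^ ℓ * K := Nat.mul_le_mul_right _ (Nat.descFactorial_le_pow _ _)
          _ = K * k ^ ℓ := mul_comm _ _
      -- As `2 * d * ℓ ≤ k`, lowering each fiber size by `ℓ - 1` costs at most half of the
      -- guaranteed total.
      have hlin : k * K ≤ (2 * d) * ∑ y, ((F y).card + 1 - ℓ) := by
        have h1 : B.card ≤ (∑ y, ((F y).card + 1 - ℓ)) + K * ℓ := by
          rw [← hsumF, ← hKcard, ← smul_eq_mul, ← Finset.sum_const, ← Finset.sum_add_distrib]
          exact Finset.sum_le_sum fun y _ => by omega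
        have h2 : 2 * d * ℓ ≤ k := by
          refine le_trans ?_ hk
          have : 4 * d ≤ (4 * d) ^ ℓ ^ (m + 1) :=
            Nat.le_self_pow (by positivity) _
          nlinarith
        have h3 : k * K ≤ B.card * d := by
          rw [hK, ← pow_succ']
          exact hB
        have h4 := Nat.mul_le_mul_right (2 * d) h1
        have h5 := Nat.mul_le_mul_right K h2
        nlinarith
      obtain ⟨n, rfl⟩ : ∃ n, ℓ = n + 1 := ⟨ℓ - 1, by omega⟩
      have hpow := pow_sum_le_card_mul_sum_pow (s := (Finset.univ : Finset (Fin (m + 1) → κ)))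
        (f := fun y => (F y).card + 1 - (n + 1)) (fun _ _ => Nat.zero_le _) n
      rw [hKcard, Nat.cast_id] at hpow
      have h1 := Nat.pow_le_pow_left hlin (n + 1)
      rw [mul_pow, mul_pow _ (∑ y, _)] at h1
      have h2 : k ^ (n + 1) * K ^ (n + 1) ≤
          K ^ n * ((∑ y, ((F y).card + 1 - (n + 1)) ^ (n + 1)) * (2 * d) ^ (n + 1)) := by
        refine h1.trans ((Nat.mul_le_mul_left _ hpow).trans_eq ?_)
        rw [mul_left_comm, mul_comm (_ ^ (n + 1))]
      have h3 := Nat.mul_lt_mul_of_pos_left hupper (pow_pos (pow_pos hkpos (m + 1)) n)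
      rw [← hK] at h3
      have h4 : K ^ n * (K * k ^ (n + 1)) = k ^ (n + 1) * K ^ (n + 1) := by ring
      omega
    -- The factor `4` lets the bound reproduce itself: `4 * (2 * d) ^ ℓ ≤ (4 * d) ^ ℓ`, because `2 ≤
    -- ℓ`.
    have hbound : ℓ * (4 * (2 * d) ^ ℓ) ^ ℓ ^ m ≤ k := by
      refine le_trans (Nat.mul_le_mul_left _ ?_) hk
      rw [pow_succ', pow_mul]
      refine Nat.pow_le_pow_left ?_ _
      have h4 : 2 ^ 2 ≤ 2 ^ ℓ := Nat.pow_le_pow_right (by norm_num) hℓ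
      calc 4 * (2 * d) ^ ℓ ≤ 2 ^ ℓ * (2 * d) ^ ℓ := Nat.mul_le_mul_right _ h4
        _ = (4 * d) ^ ℓ := by rw [← mul_pow]; ring
    obtain ⟨S', hS', hbox⟩ := ih _ (C S) (Nat.one_le_pow _ _ (by omega)) hCS hbound
    refine ⟨Fin.cons S S', ?_, ?_⟩
    · intro i
      cases i using Fin.cases with
      | zero => simpa using hS
      | succ i => simpa using hS' i
    · intro f hf
      rw [Fintype.mem_piFinset] at hf
      have h0 : f 0 ∈ S := by simpa using hf 0
      have h1 : Fin.tail f ∈ C S := hbox (Fintype.mem_piFinset.2 fun i => by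
        simpa [Fin.tail] using hf i.succ)
      have h2 := (Finset.mem_filter.1 h1).2 h0
      simpa [F] using h2

/-! ### Covering by box-free sets -/

/-- A set of functions that contains no box with all sides of size `ℓ`. -/
def BoxFree {ι κ : Type*} (ℓ : ℕ) (B : Set (ι → κ)) : Prop :=
  ∀ S : ι → Finset κ, (∀ i, (S i).card = ℓ) → ∃ f, (∀ i, f i ∈ S i) ∧ f ∉ B

/-- Few sets without `ℓ`-boxes do not cover `Fin n → κ`; here `r` bounds the number `n` of
coordinates. -/
def NoBoxFreeCover (κ : Type*) (ℓ r : ℕ) : Prop :=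
  ∀ (n : ℕ) (𝓑 : Finset (Set (Fin n → κ))), n ≤ r → 𝓑.card ≤ ℓ ^ r →
    (∀ B ∈ 𝓑, BoxFree ℓ B) → ∃ c, ∀ B ∈ 𝓑, c ∉ B

/-- In one coordinate a box-free set has at most `ℓ - 1` points, so `ℓ` of them cover at most `ℓ *
(ℓ - 1)` colors. -/
theorem noBoxFreeCover_one {k ℓ : ℕ} (hk : ℓ * (ℓ - 1) < k) : NoBoxFreeCover (Fin k) ℓ 1 := by
  classical
  intro n 𝓑 hn hcard hB
  by_contra! hcov
  rw [pow_one] at hcard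
  rcases Nat.le_one_iff_eq_zero_or_eq_one.1 hn with rfl | rfl
  · obtain ⟨B, hB𝓑, hc⟩ := hcov finZeroElim
    obtain ⟨f, -, hf⟩ := hB B hB𝓑 finZeroElim (fun i => i.elim0)
    exact hf (Subsingleton.elim finZeroElim f ▸ hc)
  · have hsmall : ∀ B ∈ 𝓑, (Finset.univ.filter fun a : Fin k => (fun _ => a) ∈ B).card ≤ ℓ - 1 := by
      intro B hB𝓑
      by_contra! hlt
      obtain ⟨S, hS, hSc⟩ := Finset.exists_subset_card_eq (Nat.le_of_pred_lt hlt)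
      obtain ⟨f, hfS, hf⟩ := hB B hB𝓑 (fun _ => S) (fun _ => hSc)
      have := (Finset.mem_filter.1 (hS (hfS 0))).2
      refine hf ?_
      convert this using 1
      funext i
      rw [Fin.fin_one_eq_zero i]
    have hsub : (Finset.univ : Finset (Fin k)) ⊆
        𝓑.biUnion fun B => Finset.univ.filter fun a : Fin k => (fun _ => a) ∈ B := by
      intro a _
      obtain ⟨B, hB𝓑, hc⟩ := hcov fun _ => a
      exact Finset.mem_biUnion.2 ⟨B, hB𝓑, by simpa using hc⟩
    have h1 := (Finset.card_le_card hsub).trans (Finset.card_biUnion_le_card_mul _ _ _ hsmall)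
    rw [Finset.card_univ, Fintype.card_fin] at h1
    exact absurd (h1.trans (Nat.mul_le_mul_right _ hcard)) (by omega)

/-- In a cover, one of the at most `ℓ ^ r` sets has density at least `1 / ℓ ^ r`; the box theorem
with `d = ℓ ^ r` then finds a box in it. -/
theorem noBoxFreeCover_of_two_le {k ℓ r : ℕ} (hℓ : 2 ≤ ℓ) (hr : 2 ≤ r)
    (hk : (3 * ℓ) ^ (r * ℓ ^ (r - 1)) ≤ k) : NoBoxFreeCover (Fin k) ℓ r := by
  classical
  intro n 𝓑 hn hcard hB
  by_contra! hcov
  have hsub : (Finset.univ : Finset (Fin n → Fin k)) ⊆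
      𝓑.biUnion fun B => Finset.univ.filter fun c => c ∈ B := by
    intro c _
    obtain ⟨B, hB𝓑, hc⟩ := hcov c
    exact Finset.mem_biUnion.2 ⟨B, hB𝓑, by simpa using hc⟩
  have h1 := (Finset.card_le_card hsub).trans Finset.card_biUnion_le
  have hkpos : 0 < k := lt_of_lt_of_le (by positivity) hk
  have hne : 𝓑.Nonempty := by
    obtain ⟨B, h, -⟩ := hcov fun _ => ⟨0, hkpos⟩
    exact ⟨B, h⟩
  obtain ⟨B, hB𝓑, hBc⟩ : ∃ B ∈ 𝓑, k ^ n ≤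
      (Finset.univ.filter fun c : Fin n → Fin k => c ∈ B).card * ℓ ^ r := by
    by_contra! hlt
    have h2 := Finset.sum_lt_sum_of_nonempty hne hlt
    rw [← Finset.sum_mul, Finset.sum_const, smul_eq_mul] at h2
    rw [Finset.card_univ, Fintype.card_fun, Fintype.card_fin, Fintype.card_fin] at h1
    have h3 := Nat.mul_le_mul_right (ℓ ^ r) h1
    have h4 := Nat.mul_le_mul_right (k ^ n) hcard
    rw [mul_comm (ℓ ^ r)] at h4
    omega
  cases n with
  | zero =>
    obtain ⟨B, hB𝓑, hc⟩ := hcov finZeroElim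
    obtain ⟨f, -, hf⟩ := hB B hB𝓑 finZeroElim (fun i => i.elim0)
    exact hf (Subsingleton.elim finZeroElim f ▸ hc)
  | succ m =>
    have hbound : ℓ * (4 * ℓ ^ r) ^ ℓ ^ m ≤ Fintype.card (Fin k) := by
      rw [Fintype.card_fin]
      refine le_trans ?_ hk
      set N := ℓ ^ (r - 1)
      have hmN : ℓ ^ m ≤ N := Nat.pow_le_pow_right (by omega) (by omega)
      have hℓN : ℓ ≤ N := Nat.le_self_pow (by omega) _
      have hℓ2 : ℓ ≤ 2 ^ N := hℓN.trans Nat.lt_two_pow_self.le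
      calc ℓ * (4 * ℓ ^ r) ^ ℓ ^ m ≤ 2 ^ N * (4 * ℓ ^ r) ^ N :=
            Nat.mul_le_mul hℓ2 (Nat.pow_le_pow_right (by positivity) hmN)
        _ = (8 * ℓ ^ r) ^ N := by rw [← mul_pow]; ring
        _ ≤ (3 ^ r * ℓ ^ r) ^ N := by
            refine Nat.pow_le_pow_left (Nat.mul_le_mul_right _ ?_) _
            exact le_trans (by norm_num : 8 ≤ 3 ^ 2) (Nat.pow_le_pow_right (by norm_num) hr)
        _ = (3 * ℓ) ^ (r * N) := by rw [← mul_pow, ← pow_mul]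
    obtain ⟨S, hS, hSB⟩ := exists_piFinset_subset_of_card hℓ m (ℓ ^ r) _
      (Nat.one_le_pow _ _ (by omega)) (by rwa [Fintype.card_fin]) hbound
    obtain ⟨f, hfS, hf⟩ := hB B hB𝓑 S hS
    exact hf (by simpa using hSB (Fintype.mem_piFinset.2 hfS))

/-! ### Branches of the rooted tree -/

/-- The vertices in the parts at or below `j`, for a vertex partition `p : V → ι` into parts
arranged in a rooted tree with parent map `par`. -/
def branch {V ι : Type*} (p : V → ι) (par : ι → ι) (j : ι) : Set V :=
  {v | ∃ n : ℕ, par^[n] (p v) = j}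

section Branch

variable {V ι : Type*} {p : V → ι} {par : ι → ι} {ρ : ι} {dep : ι → ℕ}

theorem mem_branch_of_eq {v : V} {j : ι} (h : p v = j) : v ∈ branch p par j := ⟨0, h⟩

theorem mem_branch_par {v : V} {c : ι} (h : v ∈ branch p par c) : v ∈ branch p par (par c) := by
  obtain ⟨n, hn⟩ := h
  exact ⟨n + 1, by rw [Function.iterate_succ_apply', hn]⟩

theorem exists_child_of_mem_branch (hρ : par ρ = ρ) {v : V} {j : ι} (h : v ∈ branch p par j)
    (hne : p v ≠ j) : ∃ c, (par c = j ∧ c ≠ ρ) ∧ v ∈ branch p par c := by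
  obtain ⟨n, hn⟩ := h
  induction n with
  | zero => exact absurd hn hne
  | succ n ih =>
    -- The root is its own parent, so a step taken there is idle and is dropped.
    by_cases hc : par^[n] (p v) = ρ
    · rw [Function.iterate_succ_apply', hc, hρ] at hn
      exact ih (hc.trans hn)
    · exact ⟨_, ⟨by rw [← hn, Function.iterate_succ_apply'], hc⟩, n, rfl⟩

theorem dep_iterate_le (hρ : par ρ = ρ) (hdep : ∀ a, a ≠ ρ → dep (par a) < dep a) (n : ℕ) (a : ι) :
    dep (par^[n] a) ≤ dep a := by
  induction n with
  | zero => exact le_rfl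
  | succ n ih =>
    rw [Function.iterate_succ_apply']
    by_cases h : par^[n] a = ρ
    · rwa [h, hρ, ← h]
    · exact (hdep _ h).le.trans ih

theorem dep_le_of_mem_branch (hρ : par ρ = ρ) (hdep : ∀ a, a ≠ ρ → dep (par a) < dep a) {v : V}
    {j : ι} (h : v ∈ branch p par j) : dep j ≤ dep (p v) := by
  obtain ⟨n, rfl⟩ := h
  exact dep_iterate_le hρ hdep n _

theorem notMem_branch_child (hρ : par ρ = ρ) (hdep : ∀ a, a ≠ ρ → dep (par a) < dep a) {v : V}
    {c j : ι} (hc : par c = j ∧ c ≠ ρ) (hv : p v = j) : v ∉ branch p par c := by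
  intro h
  have h1 := dep_le_of_mem_branch hρ hdep h
  have h2 := hdep c hc.2
  rw [hc.1] at h2
  rw [hv] at h1
  omega

theorem child_unique (hρ : par ρ = ρ) (hdep : ∀ a, a ≠ ρ → dep (par a) < dep a) {v : V}
    {c d j : ι} (hc : par c = j ∧ c ≠ ρ) (hd : par d = j ∧ d ≠ ρ) (hvc : v ∈ branch p par c)
    (hvd : v ∈ branch p par d) : c = d := by
  obtain ⟨m, hm⟩ := hvc
  obtain ⟨n, hn⟩ := hvd
  wlog hmn : m ≤ n generalizing m n c d
  · exact (this hd hc n hn m hm (le_of_not_ge hmn)).symm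
  obtain ⟨q, rfl⟩ := Nat.exists_eq_add_of_le' hmn
  rw [Function.iterate_add_apply, hm] at hn
  cases q with
  | zero => exact hn
  | succ q =>
    rw [Function.iterate_succ_apply, hc.1] at hn
    have h1 := dep_iterate_le hρ hdep q j
    have h2 := hdep d hd.2
    rw [hd.1] at h2
    rw [hn] at h1
    omega

/-- The separation property: edges leave a branch only from its top part to the parent part. -/
theorem mem_branch_or_of_adj {v w : V} {c j : ι} (hc : par c = j)
    (hadj : p v = p w ∨ p w = par (p v) ∨ p v = par (p w)) (hv : v ∈ branch p par c) :
    w ∈ branch p par c ∨ (p v = c ∧ p w = j) := by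
  obtain ⟨n, hn⟩ := hv
  rcases hadj with h | h | h
  · exact Or.inl ⟨n, h ▸ hn⟩
  · cases n with
    | zero =>
      have hn : p v = c := hn
      exact Or.inr ⟨hn, by rw [h, hn, hc]⟩
    | succ n => exact Or.inl ⟨n, by rw [h, ← Function.iterate_succ_apply, hn]⟩
  · exact Or.inl ⟨n + 1, by rw [Function.iterate_succ_apply, ← h, hn]⟩

end Branch

/-! ### Losing colorings of branches -/

/-- `φ` is a coloring that agrees with `y` off `D` and for which no player in `D` guesses
correctly, the guess at `v` being `g v φ`. -/
def LosingExtension {V κ : Type*} (g : V → (V → κ) → Finset κ) (D : Set V) (y φ : V → κ) : Prop :=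
  (∀ v, v ∉ D → φ v = y v) ∧ ∀ v ∈ D, φ v ∉ g v φ

section Tree

variable {V ι κ : Type*} {G : SimpleGraph V} {p : V → ι} {par : ι → ι} {ρ : ι} {dep : ι → ℕ}
  {r s ℓ : ℕ} {g : V → (V → κ) → Finset κ}

/-- If every outside coloring and all lists on the part `c` admit a losing extension to the branch
at `c`, then some fixed coloring of the vertices of `c` next to the parent `j` works for all
list colorings of `j` simultaneously. -/
theorem exists_interface [Finite V]
    (hloc : ∀ v φ ψ, (∀ w, G.Adj v w → φ w = ψ w) → g v φ = g v ψ)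
    (hadj : ∀ v w, G.Adj v w → p v = p w ∨ p w = par (p v) ∨ p v = par (p w))
    (hN : ∀ i j, i ≠ j → {v | p v = j ∧ ∃ w, p w = i ∧ G.Adj v w}.ncard ≤ r)
    (hℓ : 1 ≤ ℓ) (hcov : NoBoxFreeCover κ ℓ r) {c j : ι} (hc : par c = j) (hcj : c ≠ j)
    (ih : ∀ (y : V → κ) (L : V → Finset κ), (∀ v, (L v).card = ℓ) →
      ∃ φ, LosingExtension g (branch p par c) y φ ∧ ∀ v, p v = c → φ v ∈ L v)
    (x : V → κ) (L : V → Finset κ) (hL : ∀ v, (L v).card = ℓ) :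
    ∃ γ : V → κ, ∀ y : V → κ, (∀ v, p v = j → y v ∈ L v) →
      ∃ φ, LosingExtension g (branch p par c) y φ ∧
        ∀ v, p v = c → (∃ w, p w = j ∧ G.Adj v w) → φ v = γ v := by
  classical
  cases nonempty_fintype V
  set W : Set V := {v | p v = c ∧ ∃ w, p w = j ∧ G.Adj v w}
  set U : Set V := {v | p v = j ∧ ∃ w, p w = c ∧ G.Adj v w}
  have hWr : Fintype.card W ≤ r := by
    rw [← Nat.card_eq_fintype_card]
    exact hN j c hcj.symm
  have hUr : Fintype.card U ≤ r := by
    rw [← Nat.card_eq_fintype_card]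
    exact hN c j hcj
  let e := Fintype.equivFin W
  let Bad : (V → κ) → Set (Fin (Fintype.card W) → κ) := fun y =>
    {a | ¬ ∃ φ, LosingExtension g (branch p par c) y φ ∧ ∀ v : W, φ v = a (e v)}
  -- Use the sides of the box as lists on `W`.
  have hfree : ∀ y, BoxFree ℓ (Bad y) := by
    intro y S hS
    obtain ⟨φ, hφ, hφL⟩ := ih y (fun v => if h : v ∈ W then S (e ⟨v, h⟩) else L v)
      (fun v => by by_cases h : v ∈ W <;> simp [h, hS, hL])
    refine ⟨fun i => φ (e.symm i), fun i => ?_, fun hbad => hbad ⟨φ, hφ, fun v => by simp⟩⟩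
    simpa using hφL (e.symm i) (e.symm i).2.1
  -- Players in the branch see outside it only `U`, so `Bad y` depends only on `y` there.
  have hmono : ∀ y y' : V → κ, (∀ v ∈ U, y v = y' v) → Bad y ⊆ Bad y' := by
    rintro y y' hyy a ha ⟨φ, ⟨hφ1, hφ2⟩, hφW⟩
    refine ha ⟨fun v => if v ∈ branch p par c then φ v else y v, ⟨fun v hv => if_neg hv, ?_⟩, ?_⟩
    · intro v hv
      rw [hloc v _ φ]
      · simpa [hv] using hφ2 v hv
      · intro w hw
        by_cases hwc : w ∈ branch p par c
        · simp [hwc]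
        · rw [if_neg hwc, hφ1 w hwc]
          obtain h | ⟨h1, h2⟩ := mem_branch_or_of_adj hc (hadj v w hw) hv
          · exact absurd h hwc
          · exact hyy w ⟨h2, v, h1, hw.symm⟩
    · intro v
      exact (if_pos (mem_branch_of_eq v.2.1)).trans (hφW v)
  let ext : (U → κ) → V → κ := fun z v => if h : v ∈ U then z ⟨v, h⟩ else x v
  obtain ⟨a, ha⟩ := hcov (Fintype.card W)
    ((Fintype.piFinset fun u : U => L u).image fun z => Bad (ext z)) hWr
    (Finset.card_image_le.trans (by
      simpa [Fintype.card_piFinset, hL] using Nat.pow_le_pow_right hℓ hUr))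
    (by
      intro B hB
      obtain ⟨z, -, rfl⟩ := Finset.mem_image.1 hB
      exact hfree _)
  refine ⟨fun v => if h : v ∈ W then a (e ⟨v, h⟩) else x v, fun y hy => ?_⟩
  have hmem := ha (Bad (ext fun u => y u)) (Finset.mem_image.2 ⟨_, Fintype.mem_piFinset.2
    fun u => hy u u.2.1, rfl⟩)
  have hay : a ∉ Bad y := fun h => hmem (hmono y _ (fun v hv => by simp [ext, hv]) h)
  obtain ⟨φ, hφ, hφW⟩ := not_not.1 hay
  refine ⟨φ, hφ, fun v hv hvw => ?_⟩
  have hvW : v ∈ W := ⟨hv, hvw⟩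
  simpa only [dif_pos hvW] using hφW ⟨v, hvW⟩

/-- One step of the recursion over a rooted tree of parts: losing extensions to the branches at
the children of `j` give losing extensions to the branch at `j`. -/
theorem exists_losingExtension_of_children [Finite V] (hρ : par ρ = ρ)
    (hdep : ∀ a, a ≠ ρ → dep (par a) < dep a)
    (hcard : ∀ v φ, (g v φ).card ≤ s)
    (hloc : ∀ v φ ψ, (∀ w, G.Adj v w → φ w = ψ w) → g v φ = g v ψ)
    (hadj : ∀ v w, G.Adj v w → p v = p w ∨ p w = par (p v) ∨ p v = par (p w))
    (hN : ∀ i j, i ≠ j → {v | p v = j ∧ ∃ w, p w = i ∧ G.Adj v w}.ncard ≤ r)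
    (hlose : ∀ i, ¬ PlayersWin (G.induce {v | p v = i}) s ℓ)
    (hℓ : 1 ≤ ℓ) (hcov : NoBoxFreeCover κ ℓ r) {j : ι}
    (ih : ∀ c, par c = j ∧ c ≠ ρ → ∀ (y : V → κ) (L : V → Finset κ), (∀ v, (L v).card = ℓ) →
      ∃ φ, LosingExtension g (branch p par c) y φ ∧ ∀ v, p v = c → φ v ∈ L v)
    (x : V → κ) (L : V → Finset κ) (hL : ∀ v, (L v).card = ℓ) :
    ∃ φ, LosingExtension g (branch p par j) x φ ∧ ∀ v, p v = j → φ v ∈ L v := by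
  classical
  have hγ : ∀ c, ∃ γ : V → κ, par c = j ∧ c ≠ ρ → ∀ y : V → κ, (∀ v, p v = j → y v ∈ L v) →
      ∃ φ, LosingExtension g (branch p par c) y φ ∧
        ∀ v, p v = c → (∃ w, p w = j ∧ G.Adj v w) → φ v = γ v := by
    intro c
    by_cases hc : par c = j ∧ c ≠ ρ
    · have hcj : c ≠ j := by
        rintro rfl
        have := hdep c hc.2
        rw [hc.1] at this
        exact lt_irrefl _ this
      obtain ⟨γ, h⟩ := exists_interface hloc hadj hN hℓ hcov hc.1 hcj (ih c hc) x L hL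
      exact ⟨γ, fun _ => h⟩
    · exact ⟨x, fun h => absurd h hc⟩
  choose γ hγ using hγ
  -- The children's interfaces are frozen before part `j` is colored.
  let x' : V → κ := fun v => if par (p v) = j ∧ p v ≠ ρ then γ (p v) v else x v
  let glue : ({v | p v = j} → κ) → V → κ := fun φ w => if h : p w = j then φ ⟨w, h⟩ else x' w
  obtain ⟨φ₁, hφ₁L, hφ₁⟩ := exists_coloring_of_lists (hlose j)
    (fun v φ => g v (glue φ)) (fun v φ => hcard v _)
    (fun v φ ψ h => hloc v _ _ fun w hw => by
      by_cases hwj : p w = j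
      · simpa [glue, hwj] using h ⟨w, hwj⟩ hw
      · simp [glue, hwj])
    (fun v => L v) (fun v => hL v)
  set φ₀ := glue φ₁ with hφ₀
  have hφ₀L : ∀ v, p v = j → φ₀ v ∈ L v := fun v hv => by
    simpa [hφ₀, glue, hv] using hφ₁L ⟨v, hv⟩
  have hφ₀g : ∀ v, p v = j → φ₀ v ∉ g v φ₀ := fun v hv => by
    have h : φ₀ v = φ₁ ⟨v, hv⟩ := by simp [hφ₀, glue, hv]
    rw [h]
    exact hφ₁ ⟨v, hv⟩
  have hφ₀x : ∀ v, p v ≠ j → φ₀ v = x' v := fun v hv => by simp [hφ₀, glue, hv]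
  have hψ : ∀ c, ∃ ψ : V → κ, par c = j ∧ c ≠ ρ → LosingExtension g (branch p par c) φ₀ ψ ∧
      ∀ v, p v = c → (∃ w, p w = j ∧ G.Adj v w) → ψ v = γ c v := by
    intro c
    by_cases hc : par c = j ∧ c ≠ ρ
    · obtain ⟨ψ, h⟩ := hγ c hc φ₀ hφ₀L
      exact ⟨ψ, fun _ => h⟩
    · exact ⟨x, fun h => absurd h hc⟩
  choose ψ hψ using hψ
  -- The chosen child is unique by `child_unique`, so the branch colorings glue consistently.
  let Φ : V → κ := fun v =>
    if h : ∃ c, (par c = j ∧ c ≠ ρ) ∧ v ∈ branch p par c then ψ h.choose v else φ₀ v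
  have hΦ : ∀ c v, par c = j ∧ c ≠ ρ → v ∈ branch p par c → Φ v = ψ c v := by
    intro c v hc hv
    have h : ∃ c, (par c = j ∧ c ≠ ρ) ∧ v ∈ branch p par c := ⟨c, hc, hv⟩
    simp only [Φ, dif_pos h]
    rw [child_unique hρ hdep h.choose_spec.1 hc h.choose_spec.2 hv]
  have hΦ₀ : ∀ v, (∀ c, par c = j ∧ c ≠ ρ → v ∉ branch p par c) → Φ v = φ₀ v := by
    intro v hv
    exact dif_neg fun ⟨c, hc, hvc⟩ => hv c hc hvc
  have hΦj : ∀ v, p v = j → Φ v = φ₀ v := fun v hv =>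
    hΦ₀ v fun c hc => notMem_branch_child hρ hdep hc hv
  refine ⟨Φ, ⟨fun v hv => ?_, fun v hv => ?_⟩, fun v hv => hΦj v hv ▸ hφ₀L v hv⟩
  · have hvc : ∀ c, par c = j ∧ c ≠ ρ → v ∉ branch p par c := fun c hc h =>
      hv (hc.1 ▸ mem_branch_par h)
    rw [hΦ₀ v hvc, hφ₀x v fun h => hv (mem_branch_of_eq h)]
    exact if_neg fun hc => hvc _ hc (mem_branch_of_eq rfl)
  · by_cases hvj : p v = j
    · rw [hΦj v hvj, hloc v Φ φ₀]
      · exact hφ₀g v hvj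
      · intro w hw
        by_cases hwc : ∃ c, (par c = j ∧ c ≠ ρ) ∧ w ∈ branch p par c
        · obtain ⟨c, hc, hwc⟩ := hwc
          obtain h | ⟨h, -⟩ := mem_branch_or_of_adj hc.1 (hadj w v hw.symm) hwc
          · exact absurd h (notMem_branch_child hρ hdep hc hvj)
          -- On the interface `ψ c` equals the frozen pattern, so players in part `j` see what they
          -- saw under `φ₀`.
          · rw [hΦ c w hc hwc, (hψ c hc).2 w h ⟨v, hvj, hw.symm⟩, hφ₀x w]
            · subst h
              exact (if_pos hc).symm
            · exact fun hwj => notMem_branch_child hρ hdep hc hwj hwc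
        · exact hΦ₀ w fun c hc h => hwc ⟨c, hc, h⟩
    · obtain ⟨c, hc, hvc⟩ := exists_child_of_mem_branch hρ hv hvj
      rw [hΦ c v hc hvc, hloc v Φ (ψ c)]
      · exact (hψ c hc).1.2 v hvc
      · intro w hw
        by_cases hwc : w ∈ branch p par c
        · exact hΦ c w hc hwc
        · obtain h | ⟨-, h⟩ := mem_branch_or_of_adj hc.1 (hadj v w hw) hvc
          · exact absurd h hwc
          · rw [hΦj w h, (hψ c hc).1.1 w hwc]

/-- If the players lose with `ℓ` colors on every part of a tree-like partition whose parts are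
joined through at most `r` vertices, they lose on the whole graph with `k` colors, provided that
`ℓ ^ r` sets without `ℓ`-boxes cannot cover `Fin r → Fin k`. -/
theorem not_playersWin_of_parts [Finite V] [Finite ι] (hρ : par ρ = ρ)
    (hdep : ∀ a, a ≠ ρ → dep (par a) < dep a)
    (hadj : ∀ v w, G.Adj v w → p v = p w ∨ p w = par (p v) ∨ p v = par (p w))
    (hN : ∀ i j, i ≠ j → {v | p v = j ∧ ∃ w, p w = i ∧ G.Adj v w}.ncard ≤ r)
    (hlose : ∀ i, ¬ PlayersWin (G.induce {v | p v = i}) s ℓ)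
    (hℓ : 1 ≤ ℓ) {k : ℕ} (hk : ℓ ≤ k) (hcov : NoBoxFreeCover (Fin k) ℓ r) :
    ¬ PlayersWin G s k := by
  classical
  rintro ⟨Γ, hΓ⟩
  let g : V → (V → Fin k) → Finset (Fin k) := fun v φ => Γ.guess v fun u => φ u
  have hloc : ∀ v φ ψ, (∀ w, G.Adj v w → φ w = ψ w) → g v φ = g v ψ := by
    intro v φ ψ h
    have : (fun u : G.neighborSet v => φ u) = fun u : G.neighborSet v => ψ u :=
      funext fun u => h u u.2
    simp only [g, this]
  obtain ⟨M, hM⟩ := Set.finite_range dep |>.bddAbove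
  -- Induction from the deepest parts upward; `N = 0` is vacuous, as depths are at most `M`.
  have key : ∀ (N : ℕ) (j : ι), M < dep j + N → ∀ (y : V → Fin k) (L : V → Finset (Fin k)),
      (∀ v, (L v).card = ℓ) →
      ∃ φ, LosingExtension g (branch p par j) y φ ∧ ∀ v, p v = j → φ v ∈ L v := by
    intro N
    induction N with
    | zero =>
      intro j hj
      have := hM ⟨j, rfl⟩
      omega
    | succ N ih =>
      intro j hj
      refine exists_losingExtension_of_children hρ hdep (fun v φ => Γ.card_guess_le v _) hloc hadj
        hN hlose hℓ hcov fun c hc => ih c ?_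
      have := hdep c hc.2
      rw [hc.1] at this
      omega
  obtain ⟨S, -, hS⟩ := Finset.exists_subset_card_eq
    (s := (Finset.univ : Finset (Fin k))) (n := ℓ) (by simpa using hk)
  obtain ⟨φ, ⟨-, hφ⟩, -⟩ := key (M + 1) ρ (by omega) (fun _ => ⟨0, by omega⟩) (fun _ => S)
    fun _ => hS
  obtain ⟨v, hv⟩ := hΓ φ
  refine hφ v ?_ hv
  -- Every part descends from `ρ`, so the branch at `ρ` is all of `V`.
  have : ∀ n a, dep a ≤ n → ∃ m, par^[m] a = ρ := by
    intro n
    induction n with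
    | zero =>
      intro a ha
      by_contra! h
      have := hdep a (h 0)
      omega
    | succ n ih =>
      intro a ha
      by_cases h : a = ρ
      · exact ⟨0, h⟩
      · obtain ⟨m, hm⟩ := ih (par a) (by have := hdep a h; omega)
        exact ⟨m + 1, hm⟩
  exact this _ _ le_rfl

end Tree

/-! ### From hat guessing numbers to the theorem -/

theorem not_playersWin_of_HG_lt {V : Type*} [Finite V] {G : SimpleGraph V} {s k : ℕ}
    (h : HG G s < k) : ¬ PlayersWin G s k := by
  cases nonempty_fintype V
  intro hw
  exact absurd (le_csSup ⟨Fintype.card V * s, fun _ hk => PlayersWin.le hk⟩ hw) (not_le.2 h)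

theorem le_HG {V : Type*} [Finite V] [Nonempty V] (G : SimpleGraph V) (s : ℕ) : s ≤ HG G s :=
  (isGreatest_HG G s).2 ⟨⟨fun _ _ => Finset.univ, by simp⟩,
    fun _ => ⟨Classical.arbitrary V, Finset.mem_univ _⟩⟩

end HatGuessing

open HatGuessing in
theorem theorem2p5 {V : Type*} [Finite V] (G : SimpleGraph V) (r s ℓ t : ℕ)
    (hr : 1 ≤ r) (hs : 1 ≤ s)
    (P : Fin t → Set V) (hP : HatGuessing.IsVertexPartition P)
    (htree : (HatGuessing.quotientGraph G P).IsTree)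
    (hN : ∀ i j : Fin t, i ≠ j → (HatGuessing.nbhd G (P i) ∩ P j).ncard ≤ r)
    (hHG : ∀ i : Fin t, HatGuessing.HG (G.induce (P i)) s < ℓ) :
    (2 ≤ r → HatGuessing.HG G s ≤ (3 * ℓ) ^ (r * ℓ ^ (r - 1))) ∧
      (r = 1 → HatGuessing.HG G s ≤ ℓ * (ℓ - 1)) := by
  obtain ⟨ρ, par, dep, hρ, hdep, hpar⟩ := exists_parent_of_isTree htree
  choose p hp using hP.cover
  have hpP : ∀ v i, v ∈ P i ↔ p v = i := by
    refine fun v i => ⟨fun h => ?_, fun h => h ▸ hp v⟩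
    by_contra hne
    exact Set.disjoint_left.1 (hP.disjoint _ _ hne) (hp v) h
  have hPset : ∀ i, P i = {v | p v = i} := fun i => Set.ext fun v => hpP v i
  have hℓ : 2 ≤ ℓ := by
    have := (hP.nonempty ρ).to_subtype
    have := le_HG (G.induce (P ρ)) s
    have := hHG ρ
    omega
  have hadj : ∀ v w, G.Adj v w → p v = p w ∨ p w = par (p v) ∨ p v = par (p w) := by
    intro v w h
    by_cases he : p v = p w
    · exact Or.inl he
    · exact Or.inr (hpar _ _ ⟨he, v, hp v, w, hp w, h⟩)
  have hN' : ∀ i j, i ≠ j → {v | p v = j ∧ ∃ w, p w = i ∧ G.Adj v w}.ncard ≤ r := by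
    intro i j hij
    convert hN i j hij using 2
    ext v
    simp only [nbhd, hpP, Set.mem_inter_iff, Set.mem_ofPred_eq]
    exact and_comm
  have hlose : ∀ i, ¬ PlayersWin (G.induce {v | p v = i}) s ℓ := fun i => by
    rw [← hPset i]
    exact not_playersWin_of_HG_lt (hHG i)
  -- `ℓ ≤ b + 1` ensures that any `k > b` leaves enough colors for lists of size `ℓ`.
  have hfin : ∀ b, ℓ ≤ b + 1 → (∀ k, b < k → NoBoxFreeCover (Fin k) ℓ r) → HG G s ≤ b := by
    intro b hb h
    refine csSup_le' fun k hk => ?_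
    by_contra! hlt
    exact not_playersWin_of_parts hρ hdep hadj hN' hlose (by omega) (by omega) (h k hlt) hk
  refine ⟨fun hr2 => hfin _ ?_ fun k hk => noBoxFreeCover_of_two_le hℓ hr2 hk.le, ?_⟩
  · have : 3 * ℓ ≤ (3 * ℓ) ^ (r * ℓ ^ (r - 1)) := Nat.le_self_pow (by positivity) _
    omega
  · rintro rfl
    refine hfin _ ?_ fun k hk => noBoxFreeCover_one hk
    have : ℓ * 1 ≤ ℓ * (ℓ - 1) := Nat.mul_le_mul_left _ (by omega)
    omega
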